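/- Let $S^n$ be the space of real symmetric $n\times n$ matrices, let $L:S^n\to S^n$ be linear and monotone, i.e. $\mathrm{Tr}(X\,L(X))\ge 0$ for all $X\in S^n$, and let $Q\in S^n$. Put $$\psi(t)=\tfrac12\Big(2t^2+\tfrac1{t^2}-5\Big)+e^{\frac1t-1}\quad(t>0),$$ and for $V\in S^n$, $V\succ0$, let $\psi(V)$, $\psi'(V)$ be the matrix functions defined through the eigenvalues, and $$\Psi(V)=\mathrm{Tr}\,\psi(V),\qquad \delta(V)=\tfrac12\sqrt{\mathrm{Tr}(\psi'(V)^2)}.$$ Let $\rho:[0,\infty)\to(0,1]$ be the inverse function of the restriction of $-\tfrac12\psi'$ to $(0,1]$. For $X,Y\succ0$ and $\mu>0$ put $P=X^{1/2}(X^{1/2}YX^{1/2})^{-1/2}X^{1/2}$, $D=P^{1/2}$, $V=\frac1{\sqrt\mu}D^{-1}XD^{-1}$, and $\Psi(X,Y,\mu)=\Psi(V)$. An inner iteration with barrier parameter $\mu$ replaces $(X,Y)$ by $(X,Y)+\alpha(\Delta X,\Delta Y)$, where $D_X=\frac1{\sqrt\mu}D^{-1}\Delta X D^{-1}$ and $D_Y=\frac1{\sqrt\mu}D\,\Delta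 Y D$ are the symmetric matrices with $$D_X+D_Y=-\psi'(V),\qquad D\,L(D D_X D)\,D=D_Y,$$ and $\alpha=1/\psi''(\rho(2\delta(V)))$ is the default step size. Let $\tau\ge1$, $0<\theta<1$, $\mu>0$, and let $X\succ0$, $Y\succ0$ satisfy $Y=L(X)+Q$ and $\Psi(X,Y,\mu)\le\tau$. An outer iteration replaces $\mu$ by $(1-\theta)\mu$ and then, starting from $(X,Y)$, performs inner iterations with barrier parameter $(1-\theta)\mu$ as long as $\Psi(X,Y,(1-\theta)\mu)>\tau$ at the current pair. Let $\Psi_0=\Psi(X,Y,(1-\theta)\mu)$ be the value at the original pair right after the update of $\mu$. Then the inner iterations can be carried out and terminate at a pair $X\succ0$, $Y\succ0$ with $Y=L(X)+Q$ and $\Psi(X,Y,(1-\theta)\mu)\le\tau$, and the total number $K$ of inner iterations in the outer iteration satisfies $$K\le 66\,\big(1+\log(2\sqrt{2\Psi_0}+1)\big)^2\,\Psi_0^{1/2}.$$ -/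

import Mathlib

noncomputable section

namespace SDLCP

/-- The kernel function `ψ(t) = (1/2)(2t² + 1/t² - 5) + e^{1/t - 1}` (meaningful for `t > 0`). -/
def psi (t : ℝ) : ℝ :=
  (1 / 2) * (2 * t ^ 2 + 1 / t ^ 2 - 5) + Real.exp (1 / t - 1)

/-- The space `Sⁿ` of real symmetric `n × n` matrices. -/
def symMat (n : ℕ) : Submodule ℝ (Matrix (Fin n) (Fin n) ℝ) where
  carrier := {A | A.IsSymm}
  add_mem' := fun hA hB => Matrix.IsSymm.add hA hB
  zero_mem' := Matrix.isSymm_zero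
  smul_mem' := fun c _ hA => Matrix.IsSymm.smul hA c

abbrev SymMat (n : ℕ) : Type := symMat n

variable {n : ℕ}

theorem isSymm_of_isSelfAdjoint {A : Matrix (Fin n) (Fin n) ℝ} (h : IsSelfAdjoint A) :
    A.IsSymm := by
  have h1 : A.conjTranspose = A := h
  rwa [Matrix.conjTranspose_eq_transpose_of_trivial] at h1

theorem isSelfAdjoint (A : SymMat n) : IsSelfAdjoint A.1 := by
  have h1 : A.1.transpose = A.1 := A.2
  rw [← Matrix.conjTranspose_eq_transpose_of_trivial] at h1
  exact h1

/-- The matrix function `f(A) = Qᵀ diag(f(λ₁), …, f(λₙ)) Q` for `A = Qᵀ diag(λ₁, …, λₙ) Q`. -/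
def matFun (f : ℝ → ℝ) (A : SymMat n) : SymMat n :=
  ⟨cfc f A.1, isSymm_of_isSelfAdjoint (cfc_predicate f A.1)⟩

/-- The congruence `A M A`. -/
def conj (A M : SymMat n) : SymMat n :=
  ⟨A.1 * M.1 * A.1, by
    have hA : A.1.transpose = A.1 := A.2
    have hM : M.1.transpose = M.1 := M.2
    change (A.1 * M.1 * A.1).transpose = A.1 * M.1 * A.1
    rw [Matrix.transpose_mul, Matrix.transpose_mul, hA, hM, Matrix.mul_assoc]⟩

/-- The inverse matrix. -/
def symInv (A : SymMat n) : SymMat n :=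
  ⟨A.1⁻¹, by
    have hA : A.1.transpose = A.1 := A.2
    change (A.1⁻¹).transpose = A.1⁻¹
    rw [Matrix.transpose_nonsing_inv, hA]⟩

/-- The symmetric square root `A^{1/2}` (of a positive semidefinite matrix). -/
def symSqrt (A : SymMat n) : SymMat n := matFun Real.sqrt A

/-- The linear transformation `L` is monotone: `X • L(X) = Tr(X L(X)) ≥ 0` for all `X ∈ Sⁿ`. -/
def IsMonotone (L : SymMat n →ₗ[ℝ] SymMat n) : Prop :=
  ∀ X : SymMat n, 0 ≤ Matrix.trace (X.1 * (L X).1)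

/-- The strictly feasible set
`F⁰ = {(X, Y) ∈ Sⁿ × Sⁿ : Y - L(X) = Q, X ≻ 0, Y ≻ 0}`. -/
def strictlyFeasible (L : SymMat n →ₗ[ℝ] SymMat n) (Q : SymMat n) : Set (SymMat n × SymMat n) :=
  {z | z.2 - L z.1 = Q ∧ z.1.1.PosDef ∧ z.2.1.PosDef}

/-- The Nesterov–Todd matrix `P = X^{1/2} (X^{1/2} Y X^{1/2})^{-1/2} X^{1/2}`. -/
def scalingP (z : SymMat n × SymMat n) : SymMat n :=
  conj (symSqrt z.1) (symInv (symSqrt (conj (symSqrt z.1) z.2)))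

/-- `D = P^{1/2}`. -/
def scalingD (z : SymMat n × SymMat n) : SymMat n := symSqrt (scalingP z)

/-- The scaled matrix `V = (1/√μ) D⁻¹ X D⁻¹`. -/
def scaledV (μ : ℝ) (z : SymMat n × SymMat n) : SymMat n :=
  (1 / √μ) • conj (symInv (scalingD z)) z.1

/-- The barrier (proximity) function `Ψ(V) = Tr(ψ(V))`. -/
def Psi (V : SymMat n) : ℝ := Matrix.trace (matFun psi V).1

/-- The proximity measure `δ(V) = (1/2) √(Tr(ψ'(V)²))`. -/
def delta (V : SymMat n) : ℝ :=
  (1 / 2) * √(Matrix.trace ((matFun (deriv psi) V).1 ^ 2))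

/-- `ρ : [0, ∞) → (0, 1]`, the inverse function of the restriction of `-(1/2)ψ'` to `(0, 1]`. -/
def rho : ℝ → ℝ := Function.invFunOn (fun t => -(1 / 2) * deriv psi t) (Set.Ioc 0 1)

/-- The default step size `1 / ψ''(ρ(2δ(V)))`. -/
def stepSize (V : SymMat n) : ℝ := 1 / deriv (deriv psi) (rho (2 * delta V))

/-- The scaled linear transformation `M ↦ D L(D M D) D`. -/
def scaledL (L : SymMat n →ₗ[ℝ] SymMat n) (D M : SymMat n) : SymMat n :=
  conj D (L (conj D M))

/-- One inner iteration for the barrier parameter `μ` takes `z = (X, Y)` to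
`z' = (X, Y) + α (ΔX, ΔY)`: the scaled directions `DX = (1/√μ) D⁻¹ ΔX D⁻¹` and
`DY = (1/√μ) D ΔY D` solve `DX + DY = -ψ'(V)`, `D L(D DX D) D = DY`, and `α` is the
default step size. -/
def InnerStep (L : SymMat n →ₗ[ℝ] SymMat n) (μ : ℝ) (z z' : SymMat n × SymMat n) : Prop :=
  ∃ DX DY ΔX ΔY : SymMat n,
    DX + DY = -matFun (deriv psi) (scaledV μ z) ∧
    scaledL L (scalingD z) DX = DY ∧
    DX = (1 / √μ) • conj (symInv (scalingD z)) ΔX ∧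
    DY = (1 / √μ) • conj (scalingD z) ΔY ∧
    z' = z + stepSize (scaledV μ z) • (ΔX, ΔY)

/-- `z 0, …, z K` are the iterates of `K` successive passes through the loop
`while Ψ > τ do (inner iteration)` for the barrier parameter `μ`, started at `z₀`. -/
def IsInnerRun (L : SymMat n →ₗ[ℝ] SymMat n) (τ μ : ℝ) (z₀ : SymMat n × SymMat n)
    (K : ℕ) (z : ℕ → SymMat n × SymMat n) : Prop :=
  z 0 = z₀ ∧ ∀ k < K, τ < Psi (scaledV μ (z k)) ∧ InnerStep L μ (z k) (z (k + 1))

end SDLCP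

end

/-! ### The scalar kernel function: derivatives, growth, and the inverse `rho`. -/

namespace SDLCP

/-! In scaled coordinates an inner step moves `V` to the pair `A = V + αE`, `B = V + αF`, where `E +
F = -ψ'(V)` and monotonicity of `L` gives `Tr(EF) ≥ 0`. Hence `Tr E² + Tr F² ≤ 4δ²`.

Two matrix inequalities drive the descent. First, the new scaled matrix `V'` satisfies `V' = R A Rᵀ
= Sᵀ B S` with `RS = 1`, which forces `2Ψ(V') ≤ Ψ(A) + Ψ(B)` (`two_mul_trace_cfc_psi_le`). Second,
scalar Taylor-type bounds at pairs of eigenvalues pass to traces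
(`trace_cfc_le_of_forall_spectrum`). Since `ψ''` is decreasing, `ψ` has quadratic upper models with
coefficient `ψ''(m)/2` on `[m, ∞)`. The choice `m = ρ(2δ)`, `α = 1/ψ''(m)` keeps the eigenvalues of
`V`, `A`, `B` above `m`, and the result is `Ψ(V') ≤ Ψ(V) - αδ²` (`InnerStep.descent`).

For the count, `Ψ ≤ δ²` and `ψ''(ρ(2δ)) ≤ 20δ(1 + log(4δ+1))²` turn this, while `Ψ > τ ≥ 1`, into a
decrease of at least `√Ψ/(33ℓ²)` with `ℓ = 1 + log(2√(2Ψ₀)+1)`. So `√Ψ` drops by at least `1/(66ℓ²)`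
per step. As `√Ψ ≥ 0`, this bounds the length of every run; since a step exists from every feasible
pair, the loop also terminates. -/

theorem tangent_le_of_hasDerivAt_two {D : Set ℝ} (hD : Convex ℝ D) {f f' f'' : ℝ → ℝ}
    (hf : ∀ x ∈ D, HasDerivAt f (f' x) x) (hf' : ∀ x ∈ D, HasDerivAt f' (f'' x) x)
    (hf'' : ∀ x ∈ D, 0 ≤ f'' x) {x y : ℝ} (hx : x ∈ D) (hy : y ∈ D) :
    f y + f' y * (x - y) ≤ f x := by
  have hconv : ConvexOn ℝ D f :=
    convexOn_of_hasDerivWithinAt2_nonneg hD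
      (fun z hz => (hf z hz).continuousAt.continuousWithinAt)
      (fun z hz => (hf z (interior_subset hz)).hasDerivWithinAt)
      (fun z hz => (hf' z (interior_subset hz)).hasDerivWithinAt)
      (fun z hz => hf'' z (interior_subset hz))
  rcases lt_trichotomy x y with h | h | h
  · have := hconv.slope_le_of_hasDerivAt hx hy h (hf y hy)
    rw [slope_def_field, div_le_iff₀ (by linarith)] at this
    linarith
  · simp [h]
  · have := hconv.le_slope_of_hasDerivAt hy hx h (hf y hy)
    rw [slope_def_field, le_div_iff₀ (by linarith)] at this
    linarith

theorem hasDerivAt_exp_one_div_sub_one {t : ℝ} (ht : 0 < t) :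
    HasDerivAt (fun x : ℝ => Real.exp (1 / x - 1)) (-(Real.exp (1 / t - 1) / t ^ 2)) t := by
  have h1 : HasDerivAt (fun x : ℝ => 1 / x - 1) (-(1 / t ^ 2)) t := by
    simpa using (hasDerivAt_inv ht.ne').sub_const (1 : ℝ)
  exact h1.exp.congr_deriv (by ring)

theorem hasDerivAt_psi {t : ℝ} (ht : 0 < t) :
    HasDerivAt psi (2 * t - 1 / t ^ 3 - Real.exp (1 / t - 1) / t ^ 2) t := by
  have h2 : HasDerivAt (fun x : ℝ => (1 / 2) * (2 * x ^ 2 + 1 / x ^ 2 - 5))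
      (2 * t - 1 / t ^ 3) t := by
    have h3 : HasDerivAt (fun x : ℝ => 1 / x ^ 2) (-(2 / t ^ 3)) t := by
      simp only [one_div]
      exact ((hasDerivAt_pow 2 t).fun_inv (by positivity)).congr_deriv (by field_simp; push_cast; ring)
    have h4 := ((((hasDerivAt_pow 2 t).const_mul 2).fun_add h3).sub_const 5).const_mul (1 / 2 : ℝ)
    exact h4.congr_deriv (by norm_num; ring)
  exact (h2.fun_add (hasDerivAt_exp_one_div_sub_one ht)).congr_deriv (by ring)

theorem deriv_psi {t : ℝ} (ht : 0 < t) :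
    deriv psi t = 2 * t - 1 / t ^ 3 - Real.exp (1 / t - 1) / t ^ 2 :=
  (hasDerivAt_psi ht).deriv

theorem hasDerivAt_deriv_psi {t : ℝ} (ht : 0 < t) :
    HasDerivAt (deriv psi)
      (2 + 3 / t ^ 4 + (2 / t ^ 3 + 1 / t ^ 4) * Real.exp (1 / t - 1)) t := by
  have h3 : HasDerivAt (fun x : ℝ => 1 / x ^ 3) (-(3 / t ^ 4)) t := by
    simp only [one_div]
    exact ((hasDerivAt_pow 3 t).fun_inv (by positivity)).congr_deriv (by field_simp; push_cast; ring)
  have h4 := (hasDerivAt_exp_one_div_sub_one ht).fun_div (hasDerivAt_pow 2 t) (by positivity)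
  have h5 := (((hasDerivAt_id t).const_mul 2).fun_sub h3).fun_sub h4
  refine HasDerivAt.congr_of_eventuallyEq ?_ (f := fun x : ℝ =>
    2 * x - 1 / x ^ 3 - Real.exp (1 / x - 1) / x ^ 2) ?_
  · exact h5.congr_deriv (by norm_num; field_simp; ring)
  · filter_upwards [lt_mem_nhds ht] with x hx using deriv_psi hx

theorem deriv_deriv_psi {t : ℝ} (ht : 0 < t) :
    deriv (deriv psi) t =
      2 + 3 / t ^ 4 + (2 / t ^ 3 + 1 / t ^ 4) * Real.exp (1 / t - 1) :=
  (hasDerivAt_deriv_psi ht).deriv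

theorem hasDerivAt_deriv_psi' {t : ℝ} (ht : 0 < t) :
    HasDerivAt (deriv psi) (deriv (deriv psi) t) t := by
  rw [deriv_deriv_psi ht]
  exact hasDerivAt_deriv_psi ht

theorem hasDerivAt_psi' {t : ℝ} (ht : 0 < t) : HasDerivAt psi (deriv psi t) t := by
  rw [deriv_psi ht]
  exact hasDerivAt_psi ht

theorem two_le_deriv_deriv_psi {t : ℝ} (ht : 0 < t) : 2 ≤ deriv (deriv psi) t := by
  rw [deriv_deriv_psi ht]
  have : 0 ≤ 3 / t ^ 4 := by positivity
  have : 0 ≤ (2 / t ^ 3 + 1 / t ^ 4) * Real.exp (1 / t - 1) := by positivity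
  linarith

theorem deriv_deriv_psi_anti {m t : ℝ} (hm : 0 < m) (h : m ≤ t) :
    deriv (deriv psi) t ≤ deriv (deriv psi) m := by
  rw [deriv_deriv_psi hm, deriv_deriv_psi (hm.trans_le h)]
  gcongr

/-- As `ψ'' ≥ 2`, the function `ψ - x²` is convex. Its tangent at `t`, evaluated at the minimizer
`1` where `ψ` vanishes, gives `ψ(t) ≤ -ψ'(t)(1-t) - (1-t)²`; completing the square finishes. -/
theorem four_mul_psi_le_sq_deriv {t : ℝ} (ht : 0 < t) : 4 * psi t ≤ deriv psi t ^ 2 := by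
  have h := tangent_le_of_hasDerivAt_two (convex_Ioi (0 : ℝ)) (f := fun x => psi x - x ^ 2)
    (f' := fun x => deriv psi x - 2 * x) (f'' := fun x => deriv (deriv psi) x - 2)
    (fun x hx => by simpa using (hasDerivAt_psi' hx).fun_sub (hasDerivAt_pow 2 x))
    (fun x hx => by
      simpa using (hasDerivAt_deriv_psi' hx).fun_sub ((hasDerivAt_id x).const_mul 2))
    (fun x hx => by linarith [two_le_deriv_deriv_psi hx])
    (x := 1) (y := t) (Set.mem_Ioi.2 one_pos) ht
  have h1 : psi 1 = 0 := by norm_num [psi]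
  simp only [h1] at h
  nlinarith [sq_nonneg (deriv psi t + 2 * (1 - t))]

theorem psi_le_quadratic {m x y : ℝ} (hm : 0 < m) (hx : m ≤ x) (hy : m ≤ y) :
    psi x ≤ psi y + deriv psi y * (x - y) + deriv (deriv psi) m / 2 * (x - y) ^ 2 := by
  have h := tangent_le_of_hasDerivAt_two (convex_Ici m)
    (f := fun x => deriv (deriv psi) m / 2 * x ^ 2 - psi x)
    (f' := fun x => deriv (deriv psi) m * x - deriv psi x)
    (f'' := fun x => deriv (deriv psi) m - deriv (deriv psi) x)
    (fun x hx => (((hasDerivAt_pow 2 x).const_mul (deriv (deriv psi) m / 2)).fun_sub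
        (hasDerivAt_psi' (hm.trans_le hx))).congr_deriv (by norm_num; ring))
    (fun x hx => by
      simpa using ((hasDerivAt_id x).const_mul (deriv (deriv psi) m)).fun_sub
        (hasDerivAt_deriv_psi' (hm.trans_le hx)))
    (fun x hx => by linarith [deriv_deriv_psi_anti hm hx]) (x := x) (y := y) hx hy
  linarith

theorem deriv_psi_sub_le {m t : ℝ} (hm : 0 < m) (h : m ≤ t) :
    deriv psi t - deriv psi m ≤ deriv (deriv psi) m * (t - m) := by
  refine (convex_Icc m t).image_sub_le_mul_sub_of_deriv_le
    (fun x hx => (hasDerivAt_deriv_psi' (hm.trans_le hx.1)).continuousAt.continuousWithinAt)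
    (fun x hx => (hasDerivAt_deriv_psi'
      (hm.trans_le (interior_subset hx).1)).differentiableAt.differentiableWithinAt)
    (fun x hx => deriv_deriv_psi_anti hm (interior_subset hx).1)
    m (Set.left_mem_Icc.2 h) t (Set.right_mem_Icc.2 h) h

theorem deriv_psi_mono {m t : ℝ} (hm : 0 < m) (h : m ≤ t) : deriv psi m ≤ deriv psi t := by
  rw [deriv_psi hm, deriv_psi (hm.trans_le h)]
  gcongr

theorem rho_spec {y : ℝ} (hy : 0 ≤ y) :
    0 < rho y ∧ rho y ≤ 1 ∧ -deriv psi (rho y) = 2 * y := by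
  have hex : ∃ t ∈ Set.Ioc (0 : ℝ) 1, -(1 / 2) * deriv psi t = y := by
    -- At `1/s`, `-ψ'` equals `s³ + e^(s-1)s² - 2/s`, at least `s - 1 = 2y`, so the intermediate
    -- value theorem applies between this point and `1`, where `ψ'` vanishes.
    set s : ℝ := 1 + 2 * y with hs
    have hs1 : 1 ≤ s := by linarith
    have ht : 0 < 1 / s := by positivity
    have ht1 : 1 / s ≤ 1 := by rw [div_le_one (by positivity)]; exact hs1
    have hcont : ContinuousOn (fun t => -(1 / 2) * deriv psi t) (Set.Icc (1 / s) 1) :=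
      continuousOn_const.mul fun x hx =>
        (hasDerivAt_deriv_psi' (ht.trans_le hx.1)).continuousAt.continuousWithinAt
    have h1 : deriv psi 1 = 0 := by rw [deriv_psi one_pos]; norm_num
    have h2 : y ≤ -(1 / 2) * deriv psi (1 / s) := by
      rw [deriv_psi ht]
      have e1 : Real.exp (1 / (1 / s) - 1) / (1 / s) ^ 2 = Real.exp (s - 1) * s ^ 2 := by
        field_simp
      have e2 : 1 / (1 / s) ^ 3 = s ^ 3 := by field_simp
      rw [e1, e2]
      have h3 : 1 ≤ Real.exp (s - 1) := Real.one_le_exp (by linarith)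
      nlinarith [mul_nonneg (sub_nonneg.2 h3) (sq_nonneg s), sq_nonneg (s - 1),
        pow_le_pow_left₀ zero_le_one hs1 2, pow_le_pow_left₀ zero_le_one hs1 3]
    obtain ⟨t, ht', hty⟩ := intermediate_value_Icc' ht1 hcont
      (show y ∈ Set.Icc (-(1 / 2) * deriv psi 1) _ from ⟨by simpa [h1] using hy, h2⟩)
    exact ⟨t, ⟨ht.trans_le ht'.1, ht'.2⟩, hty⟩
  obtain ⟨h1, h2⟩ := Function.invFunOn_pos hex
  refine ⟨h1.1, h1.2, ?_⟩
  have h2' : -(1 / 2) * deriv psi (rho y) = y := h2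
  linarith

/-- With `m = ρ(2δ)` one has `ψ'(m) = -4δ`, so `ψ'` rises by at least `2δ` from `m` to `t`. Its
slope there is at most `ψ''(m)`, so `t - m` is at least `2δ/ψ''(m)`: the room needed for a
perturbation of size `2αδ`. -/
theorem rho_add_le {δ t : ℝ} (hδ : 0 ≤ δ) (ht : 0 < t) (h : -(2 * δ) ≤ deriv psi t) :
    rho (2 * δ) + 2 * (1 / deriv (deriv psi) (rho (2 * δ)) * δ) ≤ t := by
  obtain ⟨hm, -, he⟩ := rho_spec (y := 2 * δ) (by positivity)
  set m := rho (2 * δ)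
  have hM := two_le_deriv_deriv_psi hm
  have hmt : m ≤ t := by
    by_contra! hlt
    have h1 := deriv_psi_mono ht hlt.le
    have h2 : δ = 0 := by linarith
    subst h2
    have h4 : 2 * (m - t) ≤ deriv psi m - deriv psi t := by
      refine (convex_Icc t m).mul_sub_le_image_sub_of_le_deriv
        (fun x hx => (hasDerivAt_deriv_psi' (ht.trans_le hx.1)).continuousAt.continuousWithinAt)
        (fun x hx => (hasDerivAt_deriv_psi'
          (ht.trans_le (interior_subset hx).1)).differentiableAt.differentiableWithinAt)
        (fun x hx => two_le_deriv_deriv_psi (ht.trans_le (interior_subset hx).1))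
        t (Set.left_mem_Icc.2 hlt.le) m (Set.right_mem_Icc.2 hlt.le) hlt.le
    linarith
  have h1 := deriv_psi_sub_le hm hmt
  have h2 : 2 * δ ≤ deriv (deriv psi) m * (t - m) := by linarith
  have h3 : 2 * δ / deriv (deriv psi) m ≤ t - m := by
    rw [div_le_iff₀ (by linarith)]
    linarith
  have h4 : 2 * (1 / deriv (deriv psi) m * δ) = 2 * δ / deriv (deriv psi) m := by ring
  linarith

theorem deriv_deriv_psi_rho_le {δ : ℝ} (hδ : 1 ≤ δ) :
    deriv (deriv psi) (rho (2 * δ)) ≤ 20 * δ * (1 + Real.log (4 * δ + 1)) ^ 2 := by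
  obtain ⟨hm, hm1, he⟩ := rho_spec (y := 2 * δ) (by positivity)
  set m := rho (2 * δ)
  rw [deriv_psi hm] at he
  rw [deriv_deriv_psi hm]
  obtain ⟨s, hs⟩ : ∃ s, s = 1 / m := ⟨_, rfl⟩
  have hs1 : 1 ≤ s := by rw [hs, le_div_iff₀ hm]; linarith
  have hms : m = 1 / s := by rw [hs]; field_simp
  have e2 : 1 / m ^ 3 = s ^ 3 := by rw [hs]; field_simp
  have e1 : Real.exp (1 / m - 1) / m ^ 2 = Real.exp (s - 1) * s ^ 2 := by rw [hs]; field_simp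
  rw [e1, e2] at he
  have e3 : 2 + 3 / m ^ 4 + (2 / m ^ 3 + 1 / m ^ 4) * Real.exp (1 / m - 1) =
      2 + 3 * s ^ 4 + (2 * s ^ 3 + s ^ 4) * Real.exp (s - 1) := by rw [hs]; field_simp
  rw [e3]
  set E := Real.exp (s - 1)
  have hE : 0 < E := Real.exp_pos _
  have hs2 : 1 ≤ s ^ 2 := one_le_pow₀ hs1
  have hs3 : 1 ≤ s ^ 3 := one_le_pow₀ hs1
  have hle : E ≤ 4 * δ + 1 := by nlinarith
  have hslog : s ≤ 1 + Real.log (4 * δ + 1) := by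
    have := (Real.le_log_iff_exp_le (by linarith)).2 hle
    linarith
  have hsum : s ^ 3 + E * s ^ 2 ≤ 4 * δ + 2 := by linarith
  -- Raising `s⁴` to `s⁵` and `s³E` to `s⁴E` leaves `3s²(s³ + Es²) + 2 ≤ 3s²(4δ+2) + 2`; with `δ, s
  -- ≥ 1` the constant is `12 + 6 + 2 = 20`.
  have hb : 2 + 3 * s ^ 4 + (2 * s ^ 3 + s ^ 4) * E ≤ 20 * δ * s ^ 2 := by
    have h1 : s ^ 4 ≤ s ^ 5 := pow_le_pow_right₀ hs1 (by norm_num)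
    have h2 : s ^ 3 * E ≤ s ^ 4 * E :=
      mul_le_mul_of_nonneg_right (pow_le_pow_right₀ hs1 (by norm_num)) hE.le
    have h3 : s ^ 2 * (s ^ 3 + E * s ^ 2) ≤ s ^ 2 * (4 * δ + 2) :=
      mul_le_mul_of_nonneg_left hsum (by positivity)
    nlinarith
  refine hb.trans ?_
  gcongr

end SDLCP

/-! ### Trace inequalities for matrix functions. -/

namespace SDLCP

section trace

open Matrix
open scoped MatrixOrder

variable {n : ℕ}

theorem cfc_eq_conj_diagonal {A : Matrix (Fin n) (Fin n) ℝ} (hA : A.IsHermitian) (f : ℝ → ℝ) :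
    cfc f A = (hA.eigenvectorUnitary : Matrix (Fin n) (Fin n) ℝ) *
      diagonal (f ∘ hA.eigenvalues) *
        (hA.eigenvectorUnitary : Matrix (Fin n) (Fin n) ℝ)ᵀ := by
  rw [hA.cfc_eq, IsHermitian.cfc, Unitary.conjStarAlgAut_apply, star_eq_conjTranspose,
    conjTranspose_eq_transpose_of_trivial]
  rfl

/-- The weights are the squared inner products of the two eigenbases. They do not depend on `f` and
`g`, so scalar inequalities at eigenvalue pairs can be summed into trace inequalities without
commutativity. -/
theorem trace_cfc_mul_cfc {A B : Matrix (Fin n) (Fin n) ℝ} (hA : A.IsHermitian)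
    (hB : B.IsHermitian) : ∃ w : Fin n → Fin n → ℝ, (∀ i j, 0 ≤ w i j) ∧
      ∀ f g : ℝ → ℝ, trace (cfc f A * cfc g B) =
        ∑ i, ∑ j, w i j * (f (hA.eigenvalues i) * g (hB.eigenvalues j)) := by
  set U := (hA.eigenvectorUnitary : Matrix (Fin n) (Fin n) ℝ)
  set W := (hB.eigenvectorUnitary : Matrix (Fin n) (Fin n) ℝ)
  refine ⟨fun i j => (Uᵀ * W) i j ^ 2, fun i j => sq_nonneg _, fun f g => ?_⟩
  rw [cfc_eq_conj_diagonal hA, cfc_eq_conj_diagonal hB]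
  have h1 : trace (U * diagonal (f ∘ hA.eigenvalues) * Uᵀ *
      (W * diagonal (g ∘ hB.eigenvalues) * Wᵀ)) =
      trace (diagonal (f ∘ hA.eigenvalues) * ((Uᵀ * W) * diagonal (g ∘ hB.eigenvalues) *
        (Uᵀ * W)ᵀ)) := by
    rw [transpose_mul, transpose_transpose, trace_mul_comm (diagonal _),
      trace_mul_comm _ (diagonal _)]
    rw [← trace_mul_comm (_ * _) (diagonal _), Matrix.mul_assoc U, Matrix.mul_assoc U,
      trace_mul_comm U]
    simp only [Matrix.mul_assoc]
    rw [trace_mul_comm]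
    simp only [Matrix.mul_assoc]
  change trace (U * diagonal (f ∘ hA.eigenvalues) * Uᵀ *
      (W * diagonal (g ∘ hB.eigenvalues) * Wᵀ)) = _
  rw [h1]
  simp only [trace, diag_apply, diagonal_mul, mul_apply (M := _ * _ * diagonal _),
    mul_diagonal, transpose_apply, Finset.mul_sum, Function.comp]
  exact Finset.sum_congr rfl fun i _ => Finset.sum_congr rfl fun j _ => by ring

theorem trace_cfc_le_of_forall_spectrum {A B : Matrix (Fin n) (Fin n) ℝ} (hA : A.IsHermitian)
    (hB : B.IsHermitian) (f d g : ℝ → ℝ) (c : ℝ)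
    (h : ∀ x ∈ spectrum ℝ A, ∀ y ∈ spectrum ℝ B,
      f x ≤ g y + d y * (x - y) + c * (x - y) ^ 2) :
    trace (cfc f A) ≤ trace (cfc g B) + trace (cfc d B * (A - B)) +
      c * trace ((A - B) * (A - B)) := by
  obtain ⟨w, hw, hfg⟩ := trace_cfc_mul_cfc hA hB
  have hAs : IsSelfAdjoint A := hA
  have hBs : IsSelfAdjoint B := hB
  have fA : ∀ φ : ℝ → ℝ, ContinuousOn φ (spectrum ℝ A) := fun φ =>
    finite_real_spectrum.continuousOn φ
  have fB : ∀ φ : ℝ → ℝ, ContinuousOn φ (spectrum ℝ B) := fun φ =>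
    finite_real_spectrum.continuousOn φ
  have key : ∀ (φ χ : ℝ → ℝ) (F : Matrix (Fin n) (Fin n) ℝ), F = cfc φ A * cfc χ B →
      trace F = ∑ i, ∑ j, w i j * (φ (hA.eigenvalues i) * χ (hB.eigenvalues j)) :=
    fun φ χ F hF => hF ▸ hfg φ χ
  have hA1 := cfc_const_one ℝ A
  have hB1 := cfc_const_one ℝ B
  have hAi := cfc_id' ℝ A
  have hBi := cfc_id' ℝ B
  have e1 := key f (fun _ => 1) (cfc f A) (by rw [hB1, Matrix.mul_one])
  have e2 := key (fun _ => 1) g (cfc g B) (by rw [hA1, Matrix.one_mul])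
  have e3 : trace (cfc d B * A) = _ :=
    (trace_mul_comm _ _).trans (key (fun x => x) d (A * cfc d B) (by rw [hAi]))
  have e4 := key (fun _ => 1) (fun y => d y * y) (cfc d B * B) (by
    rw [cfc_mul d (fun y => y) B (fB _) (fB _), hBi, hA1, Matrix.one_mul])
  have e5 := key (fun x => x) (fun y => y) (A * B) (by rw [hAi, hBi])
  have e6 := key (fun y => y * y) (fun _ => 1) (A * A) (by
    rw [cfc_mul (fun y => y) (fun y => y) A (fA _) (fA _), hAi, hB1, Matrix.mul_one])
  have e7 := key (fun _ => 1) (fun y => y * y) (B * B) (by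
    rw [cfc_mul (fun y => y) (fun y => y) B (fB _) (fB _), hBi, hA1, Matrix.one_mul])
  have e8 : trace ((A - B) * (A - B)) =
      trace (A * A) - 2 * trace (A * B) + trace (B * B) := by
    rw [Matrix.sub_mul, Matrix.mul_sub, Matrix.mul_sub, trace_sub, trace_sub, trace_sub,
      trace_mul_comm B A]
    ring
  rw [Matrix.mul_sub, trace_sub, e8, e1, e2, e3, e4, e5, e6, e7, ← sub_nonneg]
  simp only [Finset.mul_sum, ← Finset.sum_add_distrib, ← Finset.sum_sub_distrib]
  refine Finset.sum_nonneg fun i _ => Finset.sum_nonneg fun j _ => ?_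
  have := mul_nonneg (hw i j) (sub_nonneg.2 (h _ (hA.eigenvalues_mem_spectrum_real i) _
    (hB.eigenvalues_mem_spectrum_real j)))
  linarith

theorem trace_cfc_eq_of_charpoly_eq {A B : Matrix (Fin n) (Fin n) ℝ} (hA : A.IsHermitian)
    (hB : B.IsHermitian) (h : A.charpoly = B.charpoly) (f : ℝ → ℝ) :
    trace (cfc f A) = trace (cfc f B) := by
  have key : ∀ {C : Matrix (Fin n) (Fin n) ℝ} (hC : C.IsHermitian),
      trace (cfc f C) = (C.charpoly.roots.map f).sum := by
    intro C hC
    have hU : (hC.eigenvectorUnitary : Matrix (Fin n) (Fin n) ℝ)ᵀ *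
        (hC.eigenvectorUnitary : Matrix (Fin n) (Fin n) ℝ) = 1 := by
      have := Unitary.coe_star_mul_self hC.eigenvectorUnitary
      rwa [star_eq_conjTranspose, conjTranspose_eq_transpose_of_trivial] at this
    rw [cfc_eq_conj_diagonal hC, trace_mul_comm, ← Matrix.mul_assoc, hU, Matrix.one_mul,
      trace_diagonal, hC.roots_charpoly_eq_eigenvalues]
    simp [List.sum_ofFn]
  rw [key hA, key hB, h]

theorem trace_mul_nonneg_of_posSemidef {A K : Matrix (Fin n) (Fin n) ℝ} (hA : A.PosSemidef) :
    0 ≤ trace (A * (Kᵀ * K)) := by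
  have := (hA.mul_mul_conjTranspose_same K).trace_nonneg
  rwa [conjTranspose_eq_transpose_of_trivial, trace_mul_comm, ← Matrix.mul_assoc,
    trace_mul_comm] at this

theorem cfc_posSemidef {A : Matrix (Fin n) (Fin n) ℝ} {f : ℝ → ℝ}
    (h : ∀ x ∈ spectrum ℝ A, 0 ≤ f x) : (cfc f A).PosSemidef :=
  (cfc_nonneg h).posSemidef

theorem pos_of_mem_spectrum {A : Matrix (Fin n) (Fin n) ℝ} (hA : A.PosDef) {x : ℝ}
    (hx : x ∈ spectrum ℝ A) : 0 < x := by
  obtain ⟨i, rfl⟩ := hA.isHermitian.spectrum_real_eq_range_eigenvalues ▸ hx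
  exact hA.eigenvalues_pos i

theorem posDef_of_spectrum_pos {A : Matrix (Fin n) (Fin n) ℝ} (hA : A.IsHermitian)
    (h : ∀ x ∈ spectrum ℝ A, 0 < x) : A.PosDef :=
  hA.posDef_iff_eigenvalues_pos.2 fun i => h _ (hA.eigenvalues_mem_spectrum_real i)

theorem sq_le_trace_sq {A : Matrix (Fin n) (Fin n) ℝ} (hA : A.IsHermitian) {x : ℝ}
    (hx : x ∈ spectrum ℝ A) : x ^ 2 ≤ trace (A * A) := by
  obtain ⟨i, rfl⟩ := hA.spectrum_real_eq_range_eigenvalues ▸ hx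
  have hU : (hA.eigenvectorUnitary : Matrix (Fin n) (Fin n) ℝ)ᵀ *
      (hA.eigenvectorUnitary : Matrix (Fin n) (Fin n) ℝ) = 1 := by
    have := Unitary.coe_star_mul_self hA.eigenvectorUnitary
    rwa [star_eq_conjTranspose, conjTranspose_eq_transpose_of_trivial] at this
  have hAs : IsSelfAdjoint A := hA
  have h2 : trace (A * A) = ∑ j, hA.eigenvalues j ^ 2 := by
    rw [← sq, ← cfc_pow_id (R := ℝ) A 2, cfc_eq_conj_diagonal hA, trace_mul_comm,
      ← Matrix.mul_assoc, hU, Matrix.one_mul, trace_diagonal]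
    simp
  rw [h2]
  exact Finset.single_le_sum (f := fun j => hA.eigenvalues j ^ 2) (fun j _ => sq_nonneg _)
    (Finset.mem_univ i)

/-- Loewner order: `V ≥ (m + r)I`, and `E ≥ -rI` because each squared eigenvalue of `E` is at most
`Tr E²`. -/
theorem le_of_mem_spectrum_add {V E : Matrix (Fin n) (Fin n) ℝ} (hV : V.IsHermitian)
    (hE : E.IsHermitian) {m r : ℝ} (hr : 0 ≤ r) (hm : ∀ x ∈ spectrum ℝ V, m + r ≤ x)
    (htr : trace (E * E) ≤ r ^ 2) : ∀ x ∈ spectrum ℝ (V + E), m ≤ x := by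
  have hVs : IsSelfAdjoint V := hV
  have hEs : IsSelfAdjoint E := hE
  have h1 : algebraMap ℝ _ (m + r) ≤ V := (algebraMap_le_iff_le_spectrum hVs).2 hm
  have h2 : algebraMap ℝ _ (-r) ≤ E := (algebraMap_le_iff_le_spectrum hEs).2 fun x hx =>
    (abs_le_of_sq_le_sq' ((sq_le_trace_sq hE hx).trans htr) hr).1
  refine (algebraMap_le_iff_le_spectrum (hVs.add hEs)).1 ?_
  have := add_le_add h1 h2
  rwa [← map_add, add_neg_cancel_right] at this

/-- With `H = V^{1/2}`, `A` and `B` have the spectra of `H Sᵀ S H` and `H R Rᵀ H`. The tangent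
inequality for the convex `f` at `V` leaves a linear term containing `SᵀS + RRᵀ - 2 = (Rᵀ - S)ᵀ(Rᵀ -
S)`, by `RS = 1`; it is nonnegative because the slope `d` is. -/
theorem two_mul_trace_cfc_le {V A B R S : Matrix (Fin n) (Fin n) ℝ} (hV : V.PosDef)
    (hA : A.PosDef) (hB : B.PosDef) (hRS : R * S = 1) (hVA : V = R * A * Rᵀ)
    (hVB : V = Sᵀ * B * S) (f d : ℝ → ℝ) (hd : ∀ y, 0 < y → 0 ≤ d y)
    (hf : ∀ x y, 0 < x → 0 < y → f y + d y * (x - y) ≤ f x) :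
    2 * trace (cfc f V) ≤ trace (cfc f A) + trace (cfc f B) := by
  have hSR : S * R = 1 := mul_eq_one_comm.1 hRS
  obtain ⟨H, hHpsd, hHH⟩ : ∃ H : Matrix (Fin n) (Fin n) ℝ, Hᵀ = H ∧ H * H = V := by
    have h0 := (CFC.sqrt_nonneg V).posSemidef.isHermitian
    rw [IsHermitian, conjTranspose_eq_transpose_of_trivial] at h0
    exact ⟨CFC.sqrt V, h0, CFC.sqrt_mul_sqrt_self V hV.posSemidef.nonneg⟩
  have hST : Rᵀ * Sᵀ = 1 := by rw [← transpose_mul, hSR, transpose_one]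
  have hTS : Sᵀ * Rᵀ = 1 := by rw [← transpose_mul, hRS, transpose_one]
  have hA' : A = (S * H) * (H * Sᵀ) := by
    calc A = (S * R) * A * (Rᵀ * Sᵀ) := by rw [hSR, hST, Matrix.one_mul, Matrix.mul_one]
      _ = S * (R * A * Rᵀ) * Sᵀ := by simp only [Matrix.mul_assoc]
      _ = _ := by rw [← hVA, ← hHH]; simp only [Matrix.mul_assoc]
  have hB' : B = (Rᵀ * H) * (H * R) := by
    calc B = (Rᵀ * Sᵀ) * B * (S * R) := by rw [hSR, hST, Matrix.one_mul, Matrix.mul_one]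
      _ = Rᵀ * (Sᵀ * B * S) * R := by simp only [Matrix.mul_assoc]
      _ = _ := by rw [← hVB, ← hHH]; simp only [Matrix.mul_assoc]
  have herm : ∀ G : Matrix (Fin n) (Fin n) ℝ, (G * Gᵀ).IsHermitian := fun G => by
    simpa using isHermitian_mul_conjTranspose_self G
  have comp : ∀ {C G : Matrix (Fin n) (Fin n) ℝ}, C.PosDef → C = (G * H) * (H * Gᵀ) →
      trace (cfc f V) + trace (cfc d V * ((H * Gᵀ) * (G * H) - V)) ≤ trace (cfc f C) := by
    intro C G hC hCG
    have hh : ((H * Gᵀ) * (G * H)).IsHermitian := by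
      have := herm (H * Gᵀ)
      rwa [transpose_mul, transpose_transpose, hHpsd] at this
    have hcp : C.charpoly = ((H * Gᵀ) * (G * H)).charpoly := by
      rw [hCG, Matrix.charpoly_mul_comm]
    have hpd : ∀ x ∈ spectrum ℝ ((H * Gᵀ) * (G * H)), 0 < x := by
      intro x hx
      rw [Matrix.mem_spectrum_iff_isRoot_charpoly, ← hcp,
        ← Matrix.mem_spectrum_iff_isRoot_charpoly] at hx
      exact pos_of_mem_spectrum hC hx
    rw [trace_cfc_eq_of_charpoly_eq hC.isHermitian hh hcp]
    -- Negating everything, with quadratic coefficient `0`, turns the upper model into the tangent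
    -- lower bound.
    have := trace_cfc_le_of_forall_spectrum hh hV.isHermitian (fun x => -f x)
      (fun x => -d x) (fun x => -f x) 0 (fun x hx y hy => by
        have := hf x y (hpd x hx) (pos_of_mem_spectrum hV hy)
        linarith)
    rw [cfc_neg, cfc_neg, cfc_neg, Matrix.neg_mul, trace_neg, trace_neg, trace_neg] at this
    linarith
  have c1 := comp hA hA'
  have c2 := comp hB (G := Rᵀ) (by rw [transpose_transpose]; exact hB')
  rw [transpose_transpose] at c2
  have hK : trace (cfc d V * ((H * Sᵀ) * (S * H) - V)) +
      trace (cfc d V * ((H * R) * (Rᵀ * H) - V)) =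
      trace (cfc d V * (((Rᵀ - S) * H)ᵀ * ((Rᵀ - S) * H))) := by
    rw [← trace_add, ← Matrix.mul_add]
    congr 2
    rw [transpose_mul, transpose_sub, transpose_transpose, hHpsd]
    have : H * (R - Sᵀ) * ((Rᵀ - S) * H) =
        H * R * (Rᵀ * H) + H * Sᵀ * (S * H) - H * (R * S) * H - H * (Sᵀ * Rᵀ) * H := by
      noncomm_ring
    rw [this, hRS, hTS, Matrix.mul_one, hHH]
    abel
  have hnn := trace_mul_nonneg_of_posSemidef (K := (Rᵀ - S) * H)
    (cfc_posSemidef (A := V) (f := d) fun x hx => hd x (pos_of_mem_spectrum hV hx))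
  linarith

end trace

end SDLCP

/-! ### Descent of the barrier in scaled coordinates, then Nesterov–Todd scaling. -/

namespace SDLCP

section descent

open Matrix
open scoped MatrixOrder

variable {n : ℕ}

theorem cfc_comp_inv_eq {A : Matrix (Fin n) (Fin n) ℝ} (hA : A.PosDef) (g : ℝ → ℝ) :
    cfc (fun t => g t⁻¹) A = cfc g A⁻¹ := by
  have hAs : IsSelfAdjoint A := hA.isHermitian
  have h1 : cfc (fun t : ℝ => t⁻¹) A = A⁻¹ := by
    have := cfc_inv_id (R := ℝ) hA.isUnit.unit (by exact hAs)
    rwa [coe_units_inv] at this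
  rw [← h1, ← cfc_comp' g (fun t : ℝ => t⁻¹) A
    (((finite_real_spectrum (A := A)).image _).continuousOn _)
    (finite_real_spectrum.continuousOn _)]

theorem trace_cfc_psi_eq {A : Matrix (Fin n) (Fin n) ℝ} (hA : A.PosDef) :
    trace (cfc psi A) = trace (cfc (fun t : ℝ => t ^ 2) A) +
      trace (cfc (fun t : ℝ => t ^ 2 / 2 + Real.exp (t - 1)) A⁻¹) +
      trace (cfc (fun _ : ℝ => -(5 / 2 : ℝ)) (1 : Matrix (Fin n) (Fin n) ℝ)) := by
  have hAs : IsSelfAdjoint A := hA.isHermitian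
  have fA : ∀ φ : ℝ → ℝ, ContinuousOn φ (spectrum ℝ A) := fun φ =>
    finite_real_spectrum.continuousOn φ
  have h : psi = fun t : ℝ => t ^ 2 +
      ((fun t : ℝ => t ^ 2 / 2 + Real.exp (t - 1)) t⁻¹) + (-(5 / 2 : ℝ)) := by
    funext t
    simp only [psi, one_div, inv_pow]
    ring
  rw [cfc_const (-(5 / 2 : ℝ)) (1 : Matrix (Fin n) (Fin n) ℝ), ← cfc_const (-(5 / 2 : ℝ)) A,
    ← cfc_comp_inv_eq hA, ← trace_add, ← trace_add, ← cfc_add A _ _ (fA _) (fA _),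
    ← cfc_add A _ _ (fA _) (fA _), ← h]

/-- `ψ` is not monotone, but `ψ(t) = t² + g(1/t) - 5/2` with `g(t) = t²/2 + e^(t-1)`, and both `t²`
and `g` are convex and increasing on the positive axis. The hypotheses persist for the inverses with
`R`, `S` replaced by `Sᵀ`, `Rᵀ`, so the previous inequality applies to each piece. -/
theorem two_mul_trace_cfc_psi_le {V A B R S : Matrix (Fin n) (Fin n) ℝ} (hV : V.PosDef)
    (hA : A.PosDef) (hB : B.PosDef) (hRS : R * S = 1) (hVA : V = R * A * Rᵀ)
    (hVB : V = Sᵀ * B * S) :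
    2 * trace (cfc psi V) ≤ trace (cfc psi A) + trace (cfc psi B) := by
  have hR : R⁻¹ = S := inv_eq_right_inv hRS
  have hS : S⁻¹ = R := inv_eq_left_inv hRS
  have h1 := two_mul_trace_cfc_le hV hA hB hRS hVA hVB (fun t => t ^ 2) (fun t => 2 * t)
    (fun y hy => by positivity) (fun x y _ _ => by nlinarith [sq_nonneg (x - y)])
  have h2 := two_mul_trace_cfc_le hV.inv hA.inv hB.inv (R := Sᵀ) (S := Rᵀ)
    (by rw [← transpose_mul, hRS, transpose_one])
    (by rw [hVA, Matrix.mul_inv_rev, Matrix.mul_inv_rev, ← transpose_nonsing_inv, hR, transpose_transpose,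
      Matrix.mul_assoc])
    (by rw [hVB, Matrix.mul_inv_rev, Matrix.mul_inv_rev, ← transpose_nonsing_inv, hS, transpose_transpose,
      Matrix.mul_assoc])
    (fun t => t ^ 2 / 2 + Real.exp (t - 1)) (fun t => t + Real.exp (t - 1))
    (fun y hy => by positivity) (fun x y _ _ => by
      have h3 : Real.exp (x - 1) = Real.exp (y - 1) * Real.exp (x - y) := by
        rw [← Real.exp_add]; ring_nf
      have h4 := mul_le_mul_of_nonneg_left (Real.add_one_le_exp (x - y)) (Real.exp_pos (y - 1)).le
      rw [h3]
      nlinarith [sq_nonneg (x - y)])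
  rw [trace_cfc_psi_eq hV, trace_cfc_psi_eq hA, trace_cfc_psi_eq hB]
  linarith

theorem sq_half_sqrt_trace_sq {G : Matrix (Fin n) (Fin n) ℝ} (hG : G.IsHermitian) :
    4 * ((1 / 2) * √(trace (G ^ 2))) ^ 2 = trace (G * G) := by
  have h : 0 ≤ trace (G ^ 2) := by
    have := (posSemidef_conjTranspose_mul_self G).trace_nonneg
    rwa [hG.eq, ← sq] at this
  rw [mul_pow, Real.sq_sqrt h, sq G]
  ring

theorem isHermitian_cfc (f : ℝ → ℝ) (A : Matrix (Fin n) (Fin n) ℝ) : (cfc f A).IsHermitian :=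
  cfc_predicate f A

theorem spectrum_cfc {A : Matrix (Fin n) (Fin n) ℝ} (hA : A.IsHermitian) (f : ℝ → ℝ) :
    spectrum ℝ (cfc f A) = f '' spectrum ℝ A :=
  cfc_map_spectrum f A hA (finite_real_spectrum.continuousOn _)

theorem four_mul_trace_cfc_psi_le {V : Matrix (Fin n) (Fin n) ℝ} (hV : V.PosDef) :
    4 * trace (cfc psi V) ≤ trace (cfc (deriv psi) V * cfc (deriv psi) V) := by
  have fV : ∀ φ : ℝ → ℝ, ContinuousOn φ (spectrum ℝ V) := fun φ =>
    finite_real_spectrum.continuousOn φ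
  have h := (cfc_posSemidef (A := V) (f := fun t => deriv psi t * deriv psi t - 4 * psi t)
    fun x hx => by
      have := four_mul_psi_le_sq_deriv (pos_of_mem_spectrum hV hx)
      nlinarith).trace_nonneg
  rw [cfc_sub _ _ V (fV _) (fV _), cfc_mul _ _ V (fV _) (fV _), cfc_const_mul 4 _ V (fV _),
    trace_sub, trace_smul, smul_eq_mul] at h
  linarith

theorem trace_cfc_psi_step {V E : Matrix (Fin n) (Fin n) ℝ} (hV : V.PosDef)
    (hE : E.IsHermitian) {m r : ℝ} (hm : 0 < m) (hr : 0 ≤ r)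
    (hVm : ∀ x ∈ spectrum ℝ V, m + r ≤ x) (htr : trace (E * E) ≤ r ^ 2) :
    (V + E).PosDef ∧ trace (cfc psi (V + E)) ≤ trace (cfc psi V) +
      trace (cfc (deriv psi) V * E) + deriv (deriv psi) m / 2 * trace (E * E) := by
  have hspec := le_of_mem_spectrum_add hV.isHermitian hE hr hVm htr
  have hherm := hV.isHermitian.add hE
  refine ⟨posDef_of_spectrum_pos hherm fun x hx => hm.trans_le (hspec x hx), ?_⟩
  have := trace_cfc_le_of_forall_spectrum hherm hV.isHermitian psi (deriv psi) psi
    (deriv (deriv psi) m / 2) fun x hx y hy =>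
      psi_le_quadratic hm (hspec x hx) (by linarith [hVm y hy])
  rwa [add_sub_cancel_left] at this

/-- `Tr(EF) ≥ 0` serves twice: it bounds each of `Tr E²`, `Tr F²` by `4δ²`, which keeps the spectra
above `ρ(2δ)`, and it bounds their sum. The linear terms contribute `-4αδ²` and the quadratic ones
at most `2αδ²`. -/
theorem trace_cfc_psi_descent {V E F : Matrix (Fin n) (Fin n) ℝ} (hV : V.PosDef)
    (hE : E.IsHermitian) (hF : F.IsHermitian) (hEF : E + F = -cfc (deriv psi) V)
    (hmono : 0 ≤ trace (E * F)) {δ α : ℝ}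
    (hδ : δ = (1 / 2) * √(trace (cfc (deriv psi) V ^ 2)))
    (hα : α = 1 / deriv (deriv psi) (rho (2 * δ))) :
    (V + α • E).PosDef ∧ (V + α • F).PosDef ∧
      trace (cfc psi (V + α • E)) + trace (cfc psi (V + α • F)) ≤
        2 * (trace (cfc psi V) - α * δ ^ 2) := by
  have hG : (cfc (deriv psi) V).IsHermitian := isHermitian_cfc _ _
  have hδ0 : 0 ≤ δ := by rw [hδ]; positivity
  have hGG := sq_half_sqrt_trace_sq hG
  rw [← hδ] at hGG
  obtain ⟨hm, -, -⟩ := rho_spec (y := 2 * δ) (by positivity)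
  have hM := two_le_deriv_deriv_psi hm
  have hα0 : 0 < α := by rw [hα]; positivity
  have hαM : deriv (deriv psi) (rho (2 * δ)) * α = 1 := by
    rw [hα]; field_simp
  have nn : ∀ {C : Matrix (Fin n) (Fin n) ℝ}, C.IsHermitian → 0 ≤ trace (C * C) := by
    intro C hC
    have := (posSemidef_conjTranspose_mul_self C).trace_nonneg
    rwa [hC.eq] at this
  have hsum : trace (E * E) + trace (F * F) + 2 * trace (E * F) = 4 * δ ^ 2 := by
    have h1 : trace ((E + F) * (E + F)) = 4 * δ ^ 2 := by
      rw [hEF, neg_mul_neg, hGG]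
    rw [Matrix.add_mul, Matrix.mul_add, Matrix.mul_add, trace_add, trace_add, trace_add,
      trace_mul_comm F E] at h1
    linarith
  have hVm : ∀ x ∈ spectrum ℝ V, rho (2 * δ) + α * (2 * δ) ≤ x := by
    intro x hx
    have h1 : deriv psi x ∈ spectrum ℝ (cfc (deriv psi) V) := by
      rw [spectrum_cfc hV.isHermitian]
      exact ⟨x, hx, rfl⟩
    have h2 := sq_le_trace_sq hG h1
    have h3 := (abs_le_of_sq_le_sq' (b := 2 * δ) (by linarith) (by positivity)).1
    have := rho_add_le hδ0 (pos_of_mem_spectrum hV hx) h3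
    rw [hα]
    linarith
  have step : ∀ {C : Matrix (Fin n) (Fin n) ℝ}, C.IsHermitian → trace (C * C) ≤ 4 * δ ^ 2 →
      (V + α • C).PosDef ∧ trace (cfc psi (V + α • C)) ≤ trace (cfc psi V) +
        α * trace (cfc (deriv psi) V * C) + α / 2 * trace (C * C) := by
    intro C hC hCC
    have e : trace ((α • C) * (α • C)) = α ^ 2 * trace (C * C) := by
      rw [smul_mul_smul_comm, trace_smul, smul_eq_mul]; ring
    have hαC : (α • C).IsHermitian := by
      rw [IsHermitian, conjTranspose_smul, hC.eq, star_trivial]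
    obtain ⟨h1, h2⟩ := trace_cfc_psi_step hV hαC hm (by positivity) hVm (by
      rw [e, mul_pow]
      have := mul_le_mul_of_nonneg_left hCC (sq_nonneg α)
      linarith)
    refine ⟨h1, h2.trans_eq ?_⟩
    rw [e, Matrix.mul_smul, trace_smul, smul_eq_mul]
    linear_combination (α / 2 * trace (C * C)) * hαM
  obtain ⟨p1, q1⟩ := step hE (by linarith [nn hF])
  obtain ⟨p2, q2⟩ := step hF (by linarith [nn hE])
  refine ⟨p1, p2, ?_⟩
  have hlin : trace (cfc (deriv psi) V * E) + trace (cfc (deriv psi) V * F) = -(4 * δ ^ 2) := by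
    rw [← trace_add, ← Matrix.mul_add, hEF, Matrix.mul_neg, trace_neg, hGG]
  nlinarith [mul_nonneg hα0.le hmono]

end descent

section scaling

open Matrix

variable {n : ℕ}

theorem cfc_sqrt_posDef {A : Matrix (Fin n) (Fin n) ℝ} (hA : A.PosDef) :
    (cfc Real.sqrt A).PosDef := by
  refine posDef_of_spectrum_pos (isHermitian_cfc _ _) fun x hx => ?_
  rw [spectrum_cfc hA.isHermitian] at hx
  obtain ⟨y, hy, rfl⟩ := hx
  exact Real.sqrt_pos.2 (pos_of_mem_spectrum hA hy)

theorem cfc_sqrt_mul_self {A : Matrix (Fin n) (Fin n) ℝ} (hA : A.PosDef) :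
    cfc Real.sqrt A * cfc Real.sqrt A = A := by
  have hAs : IsSelfAdjoint A := hA.isHermitian
  rw [← cfc_mul Real.sqrt Real.sqrt A (finite_real_spectrum.continuousOn _)
    (finite_real_spectrum.continuousOn _)]
  conv_rhs => rw [← cfc_id' ℝ A]
  exact cfc_congr fun x hx => Real.mul_self_sqrt (pos_of_mem_spectrum hA hx).le

theorem posDef_conj {A M : Matrix (Fin n) (Fin n) ℝ} (hA : A.PosDef) (hM : M.PosDef) :
    (A * M * A).PosDef := by
  have := (IsUnit.posDef_star_left_conjugate_iff hA.isUnit (x := M)).2 hM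
  rwa [star_eq_conjTranspose, hA.isHermitian.eq] at this

theorem isHermitian_coe (A : SymMat n) : A.1.IsHermitian := isSelfAdjoint A

/-- Both sides agree because `P = D²` solves `P Y P = X`: the middle factor `X^{1/2} Y X^{1/2}` is
the square of the matrix inverted in `P`. -/
theorem scaling_spec {z : SymMat n × SymMat n} (hX : z.1.1.PosDef) (hY : z.2.1.PosDef) :
    (scalingD z).1.PosDef ∧
      (scalingD z).1⁻¹ * z.1.1 * (scalingD z).1⁻¹ = (scalingD z).1 * z.2.1 * (scalingD z).1 := by
  set X := z.1.1
  set Y := z.2.1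
  set H := cfc Real.sqrt X with hH
  set T := cfc Real.sqrt (H * Y * H) with hT
  have hHp : H.PosDef := cfc_sqrt_posDef hX
  have hHH : H * H = X := cfc_sqrt_mul_self hX
  have hTp : T.PosDef := cfc_sqrt_posDef (posDef_conj hHp hY)
  have hTT : T * T = H * Y * H := cfc_sqrt_mul_self (posDef_conj hHp hY)
  have hPp : (H * T⁻¹ * H).PosDef := posDef_conj hHp hTp.inv
  have hD : (scalingD z).1 = cfc Real.sqrt (H * T⁻¹ * H) := rfl
  rw [hD]
  have hDp := cfc_sqrt_posDef hPp
  have hDD := cfc_sqrt_mul_self hPp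
  set D := cfc Real.sqrt (H * T⁻¹ * H)
  have hTd : IsUnit T.det := (isUnit_iff_isUnit_det T).1 hTp.isUnit
  have hDd : IsUnit D.det := (isUnit_iff_isUnit_det D).1 hDp.isUnit
  have hPYP : (D * D) * Y * (D * D) = X := by
    calc (D * D) * Y * (D * D) = H * T⁻¹ * (H * Y * H) * T⁻¹ * H := by
          rw [hDD]; simp only [Matrix.mul_assoc]
      _ = H * (T⁻¹ * T) * (T * T⁻¹) * H := by rw [← hTT]; simp only [Matrix.mul_assoc]
      _ = X := by
        rw [nonsing_inv_mul _ hTd, mul_nonsing_inv _ hTd, Matrix.mul_one, Matrix.mul_one, hHH]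
  refine ⟨hDp, ?_⟩
  calc D⁻¹ * X * D⁻¹ = (D⁻¹ * D) * D * Y * D * (D * D⁻¹) := by
        rw [← hPYP]; simp only [Matrix.mul_assoc]
    _ = D * Y * D := by
        rw [nonsing_inv_mul _ hDd, mul_nonsing_inv _ hDd, Matrix.mul_one, Matrix.one_mul]

theorem coe_scaledV (μ : ℝ) (z : SymMat n × SymMat n) :
    (scaledV μ z).1 = (1 / √μ) • ((scalingD z).1⁻¹ * z.1.1 * (scalingD z).1⁻¹) := rfl

theorem scaledV_posDef {μ : ℝ} (hμ : 0 < μ) {z : SymMat n × SymMat n} (hX : z.1.1.PosDef)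
    (hY : z.2.1.PosDef) : (scaledV μ z).1.PosDef := by
  rw [coe_scaledV]
  exact (posDef_conj (scaling_spec hX hY).1.inv hX).smul (by positivity)

theorem eq_smul_conj_of_smul_conj_inv_eq {D M N : Matrix (Fin n) (Fin n) ℝ} {c : ℝ} (hc : 0 < c)
    (hD : IsUnit D.det) (h : M = (1 / c) • (D⁻¹ * N * D⁻¹)) : N = c • (D * M * D) := by
  have e : D * (D⁻¹ * N * D⁻¹) * D = N := by
    calc D * (D⁻¹ * N * D⁻¹) * D = (D * D⁻¹) * N * (D⁻¹ * D) := by simp only [Matrix.mul_assoc]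
      _ = N := by
        rw [nonsing_inv_mul _ hD, mul_nonsing_inv _ hD, Matrix.mul_one, Matrix.one_mul]
  rw [h, Matrix.mul_smul, Matrix.smul_mul, e, smul_smul, mul_one_div_cancel hc.ne', one_smul]

theorem eq_smul_conj_inv_of_smul_conj_eq {D M N : Matrix (Fin n) (Fin n) ℝ} {c : ℝ} (hc : 0 < c)
    (hD : IsUnit D.det) (h : M = (1 / c) • (D * N * D)) : N = c • (D⁻¹ * M * D⁻¹) := by
  refine eq_smul_conj_of_smul_conj_inv_eq hc ?_ ?_
  · rw [det_nonsing_inv, isUnit_ringInverse]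
    exact hD
  · rwa [nonsing_inv_nonsing_inv _ hD]

theorem Psi_scaledV_le {μ : ℝ} (hμ : 0 < μ) {z : SymMat n × SymMat n}
    {A B D : Matrix (Fin n) (Fin n) ℝ} (hA : A.PosDef) (hB : B.PosDef) (hD : D.PosDef)
    (hX : z.1.1 = √μ • (D * A * D)) (hY : z.2.1 = √μ • (D⁻¹ * B * D⁻¹)) :
    2 * Psi (scaledV μ z) ≤ trace (cfc psi A) + trace (cfc psi B) := by
  have hs : 0 < √μ := Real.sqrt_pos.2 hμ
  have hXp : z.1.1.PosDef := by rw [hX]; exact (posDef_conj hD hA).smul hs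
  have hYp : z.2.1.PosDef := by rw [hY]; exact (posDef_conj hD.inv hB).smul hs
  obtain ⟨hD', he⟩ := scaling_spec hXp hYp
  have hV := coe_scaledV μ z
  have hV2 := hV
  have hVp := scaledV_posDef hμ hXp hYp
  rw [he] at hV2
  rw [hX] at hV
  rw [hY] at hV2
  set D' := (scalingD z).1
  have hDd : IsUnit D.det := (isUnit_iff_isUnit_det D).1 hD.isUnit
  have hDd' : IsUnit D'.det := (isUnit_iff_isUnit_det D').1 hD'.isUnit
  have tr : ∀ {C : Matrix (Fin n) (Fin n) ℝ}, C.PosDef → Cᵀ = C := fun hC => by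
    have := hC.isHermitian.eq
    rwa [conjTranspose_eq_transpose_of_trivial] at this
  -- `D` is the scaling before the step, `D'` the one belonging to the new pair; `R` and `S` are the
  -- mutually inverse changes between them.
  refine two_mul_trace_cfc_psi_le hVp hA hB (R := D'⁻¹ * D) (S := D⁻¹ * D') ?_ ?_ ?_
  · calc D'⁻¹ * D * (D⁻¹ * D') = D'⁻¹ * (D * D⁻¹) * D' := by simp only [Matrix.mul_assoc]
      _ = 1 := by rw [mul_nonsing_inv _ hDd, Matrix.mul_one, nonsing_inv_mul _ hDd']
  · rw [hV, transpose_mul, tr hD'.inv, tr hD, Matrix.mul_smul, Matrix.smul_mul, smul_smul,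
      one_div_mul_cancel hs.ne', one_smul]
    simp only [Matrix.mul_assoc]
  · rw [hV2, transpose_mul, tr hD.inv, tr hD', Matrix.mul_smul, Matrix.smul_mul, smul_smul,
      one_div_mul_cancel hs.ne', one_smul]
    simp only [Matrix.mul_assoc]

end scaling

end SDLCP

/-! ### Existence and effect of one inner iteration. -/

namespace SDLCP

section innerStep

open Matrix

variable {n : ℕ}

theorem coe_conj (A M : SymMat n) : (conj A M).1 = A.1 * M.1 * A.1 := rfl

theorem coe_symInv (A : SymMat n) : (symInv A).1 = A.1⁻¹ := rfl

theorem conj_conj_symInv {D : SymMat n} (hD : IsUnit D.1.det) (M : SymMat n) :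
    conj D (conj (symInv D) M) = M := by
  apply Subtype.ext
  rw [coe_conj, coe_conj, coe_symInv]
  calc D.1 * (D.1⁻¹ * M.1 * D.1⁻¹) * D.1 = (D.1 * D.1⁻¹) * M.1 * (D.1⁻¹ * D.1) := by
        simp only [Matrix.mul_assoc]
    _ = M.1 := by
      rw [nonsing_inv_mul _ hD, mul_nonsing_inv _ hD, Matrix.mul_one, Matrix.one_mul]

theorem conj_symInv_conj {D : SymMat n} (hD : IsUnit D.1.det) (M : SymMat n) :
    conj (symInv D) (conj D M) = M := by
  apply Subtype.ext
  rw [coe_conj, coe_conj, coe_symInv]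
  calc D.1⁻¹ * (D.1 * M.1 * D.1) * D.1⁻¹ = (D.1⁻¹ * D.1) * M.1 * (D.1 * D.1⁻¹) := by
        simp only [Matrix.mul_assoc]
    _ = M.1 := by
      rw [nonsing_inv_mul _ hD, mul_nonsing_inv _ hD, Matrix.mul_one, Matrix.one_mul]

/-- The congruence `M ↦ D M D` as a linear map. -/
def conjLin (D : SymMat n) : SymMat n →ₗ[ℝ] SymMat n where
  toFun := conj D
  map_add' M N := by
    apply Subtype.ext
    change D.1 * (M.1 + N.1) * D.1 = D.1 * M.1 * D.1 + D.1 * N.1 * D.1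
    rw [Matrix.mul_add, Matrix.add_mul]
  map_smul' c M := by
    apply Subtype.ext
    change D.1 * (c • M.1) * D.1 = c • (D.1 * M.1 * D.1)
    rw [Matrix.mul_smul, Matrix.smul_mul]

theorem conj_smul (D : SymMat n) (c : ℝ) (M : SymMat n) : conj D (c • M) = c • conj D M :=
  (conjLin D).map_smul c M

theorem trace_mul_scaledL_nonneg {L : SymMat n →ₗ[ℝ] SymMat n} (hL : IsMonotone L)
    (D M : SymMat n) : 0 ≤ trace (M.1 * (scaledL L D M).1) := by
  have h := hL (conj D M)
  rw [coe_conj] at h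
  have e : trace (M.1 * (scaledL L D M).1) = trace (D.1 * M.1 * D.1 * (L (conj D M)).1) := by
    change trace (M.1 * (D.1 * (L (conj D M)).1 * D.1)) = _
    rw [← Matrix.mul_assoc, trace_mul_comm]
    simp only [Matrix.mul_assoc]
  rwa [e]

/-- Monotonicity survives the congruence by `D`, so a kernel element `M` has `Tr M² ≤ 0` and
vanishes; injectivity gives surjectivity in finite dimension. -/
theorem exists_add_scaledL_eq {L : SymMat n →ₗ[ℝ] SymMat n} (hL : IsMonotone L)
    (D G : SymMat n) : ∃ M, M + scaledL L D M = G := by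
  let T : SymMat n →ₗ[ℝ] SymMat n := LinearMap.id + conjLin D ∘ₗ L ∘ₗ conjLin D
  have hT : ∀ M, T M = M + scaledL L D M := fun _ => rfl
  have hinj : Function.Injective T := by
    refine (injective_iff_map_eq_zero T).2 fun M hM => ?_
    have h1 := trace_mul_scaledL_nonneg hL D M
    have h2 : scaledL L D M = -M := by
      rw [hT] at hM
      exact (neg_eq_of_add_eq_zero_right hM).symm
    rw [h2] at h1
    change 0 ≤ trace (M.1 * -M.1) at h1
    rw [Matrix.mul_neg, trace_neg] at h1
    have h3 := (posSemidef_conjTranspose_mul_self M.1).trace_nonneg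
    have h4 := trace_conjTranspose_mul_self_eq_zero_iff (A := M.1)
    rw [(isHermitian_coe M).eq] at h3 h4
    exact Subtype.ext (h4.1 (by linarith))
  obtain ⟨M, hM⟩ := LinearMap.injective_iff_surjective.1 hinj G
  exact ⟨M, (hT M).symm.trans hM⟩

theorem exists_innerStep {L : SymMat n →ₗ[ℝ] SymMat n} (hL : IsMonotone L) {μ : ℝ} (hμ : 0 < μ)
    {z : SymMat n × SymMat n} (hX : z.1.1.PosDef) (hY : z.2.1.PosDef) :
    ∃ z', InnerStep L μ z z' := by
  obtain ⟨hD, -⟩ := scaling_spec hX hY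
  have hDd := (isUnit_iff_isUnit_det _).1 hD.isUnit
  have hs : √μ ≠ 0 := (Real.sqrt_pos.2 hμ).ne'
  obtain ⟨M, hM⟩ := exists_add_scaledL_eq hL (scalingD z) (-matFun (deriv psi) (scaledV μ z))
  refine ⟨_, M, scaledL L (scalingD z) M, √μ • conj (scalingD z) M,
    √μ • conj (symInv (scalingD z)) (scaledL L (scalingD z) M), hM, rfl, ?_, ?_, rfl⟩
  · rw [conj_smul, conj_symInv_conj hDd, smul_smul, one_div_mul_cancel hs, one_smul]
  · rw [conj_smul, conj_conj_symInv hDd, smul_smul, one_div_mul_cancel hs, one_smul]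

theorem InnerStep.descent {L : SymMat n →ₗ[ℝ] SymMat n} (hL : IsMonotone L) {Q : SymMat n}
    {μ : ℝ} (hμ : 0 < μ) {z z' : SymMat n × SymMat n} (hz : z ∈ strictlyFeasible L Q)
    (h : InnerStep L μ z z') :
    z' ∈ strictlyFeasible L Q ∧
      Psi (scaledV μ z') ≤
        Psi (scaledV μ z) - stepSize (scaledV μ z) * delta (scaledV μ z) ^ 2 := by
  obtain ⟨DX, DY, ΔX, ΔY, hsum, hDL, hDX, hDY, rfl⟩ := h
  obtain ⟨hQ, hX, hY⟩ := hz
  obtain ⟨hD, he⟩ := scaling_spec hX hY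
  have hDd := (isUnit_iff_isUnit_det _).1 hD.isUnit
  have hs : 0 < √μ := Real.sqrt_pos.2 hμ
  have hVp := scaledV_posDef hμ hX hY
  have hVX := coe_scaledV μ z
  have hVY := hVX
  rw [he] at hVY
  -- Undoing the scaling recovers the unscaled Newton equation, which preserves `Y - L(X) = Q`.
  have hL' : L ΔX = ΔY := by
    have h1 : conj (scalingD z) DX = (1 / √μ) • ΔX := by
      rw [hDX, conj_smul, conj_conj_symInv hDd]
    have h2 : scaledL L (scalingD z) DX = (1 / √μ) • conj (scalingD z) (L ΔX) := by
      rw [scaledL, h1, map_smul, conj_smul]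
    rw [hDL, hDY] at h2
    have h3 := smul_right_injective (SymMat n) (one_div_pos.2 hs).ne' h2
    have h4 := congrArg (conj (symInv (scalingD z))) h3
    rw [conj_symInv_conj hDd, conj_symInv_conj hDd] at h4
    exact h4.symm
  have hX0 := eq_smul_conj_of_smul_conj_inv_eq hs hDd hVX
  have hY0 := eq_smul_conj_inv_of_smul_conj_eq hs hDd hVY
  have hX1 := eq_smul_conj_of_smul_conj_inv_eq hs hDd (congrArg Subtype.val hDX)
  have hY1 := eq_smul_conj_inv_of_smul_conj_eq hs hDd (congrArg Subtype.val hDY)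
  set α := stepSize (scaledV μ z) with hα
  obtain ⟨hA, hB, hdec⟩ := trace_cfc_psi_descent hVp (isHermitian_coe DX) (isHermitian_coe DY)
    (congrArg Subtype.val hsum) (by rw [← hDL]; exact trace_mul_scaledL_nonneg hL _ _)
    (δ := delta (scaledV μ z)) (α := α) rfl rfl
  have hX' : (z + α • (ΔX, ΔY)).1.1 =
      √μ • ((scalingD z).1 * ((scaledV μ z).1 + α • DX.1) * (scalingD z).1) := by
    change z.1.1 + α • ΔX.1 = _
    rw [hX0, hX1, Matrix.mul_add, Matrix.add_mul, Matrix.mul_smul, Matrix.smul_mul, smul_add,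
      smul_comm α]
  have hY' : (z + α • (ΔX, ΔY)).2.1 =
      √μ • ((scalingD z).1⁻¹ * ((scaledV μ z).1 + α • DY.1) * (scalingD z).1⁻¹) := by
    change z.2.1 + α • ΔY.1 = _
    rw [hY0, hY1, Matrix.mul_add, Matrix.add_mul, Matrix.mul_smul, Matrix.smul_mul, smul_add,
      smul_comm α]
  refine ⟨⟨?_, ?_, ?_⟩, ?_⟩
  · change z.2 + α • ΔY - L (z.1 + α • ΔX) = Q
    rw [map_add, map_smul, hL', ← hQ]
    abel
  · rw [hX']
    exact (posDef_conj hD hA).smul hs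
  · rw [hY']
    exact (posDef_conj hD.inv hB).smul hs
  · have h1 := Psi_scaledV_le hμ hA hB hD hX' hY'
    have h2 : Psi (scaledV μ z) = trace (cfc psi (scaledV μ z).1) := rfl
    linarith

theorem Psi_le_delta_sq {V : SymMat n} (hV : V.1.PosDef) : Psi V ≤ delta V ^ 2 := by
  have h1 := four_mul_trace_cfc_psi_le hV
  have h2 := sq_half_sqrt_trace_sq (isHermitian_cfc (deriv psi) V.1)
  have h3 : delta V = (1 / 2) * √(trace (cfc (deriv psi) V.1 ^ 2)) := rfl
  have h4 : Psi V = trace (cfc psi V.1) := rfl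
  rw [← h3] at h2
  linarith

end innerStep

/-! ### From decrease per step to the iteration count. -/

theorem sqrt_div_le_of_sqrt_le {p p₀ δ : ℝ} (hp : 1 ≤ p) (hp₀ : p ≤ p₀) (hδ : √p ≤ δ) :
    √p / (33 * (1 + Real.log (2 * √(2 * p₀) + 1)) ^ 2) ≤
      δ / (20 * (1 + Real.log (4 * δ + 1)) ^ 2) := by
  set a := 2 * √(2 * p) with ha
  set ℓ := 1 + Real.log (2 * √(2 * p₀) + 1) with hℓ
  have hsp : 1 ≤ √p := Real.one_le_sqrt.2 hp
  have hsp2 : √p ^ 2 = p := Real.sq_sqrt (by linarith)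
  have ha0 : 0 ≤ a := by positivity
  have ha2 : a ^ 2 = 8 * p := by rw [ha, mul_pow, Real.sq_sqrt (by linarith)]; ring
  have hap : 80 * √p ≤ 33 * a := abs_le_of_sq_le_sq' (by nlinarith) (by positivity) |>.2
  have hap' : a ≤ 4 * √p := abs_le_of_sq_le_sq' (by nlinarith) (by positivity) |>.2
  have hapos : 0 < a := by linarith
  have hae : Real.exp 1 ≤ a + 1 := by
    have h1 : (28 / 10 : ℝ) ≤ a := abs_le_of_sq_le_sq' (by nlinarith) (by positivity) |>.2
    linarith [Real.exp_one_lt_d9]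
  have hla : 1 ≤ Real.log (a + 1) := (Real.le_log_iff_exp_le (by linarith)).2 hae
  have hal : 1 + Real.log (a + 1) ≤ ℓ := by
    rw [hℓ, ha]
    gcongr
  -- The ratio `c ≥ 1` measures how far `4δ` exceeds `a`. From `4δ + 1 ≤ c(a + 1)` and `log c ≤ 2(√c
  -- - 1)`, with `ℓ ≥ 2`, the logarithmic factor grows at most like `√c`; its square is absorbed by
  -- the factor `δ`. What remains is `80√p ≤ 33a`.
  obtain ⟨c, hc⟩ : ∃ c, c = 4 * δ / a := ⟨_, rfl⟩
  have hca : c * a = 4 * δ := by rw [hc]; field_simp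
  have hc1 : 1 ≤ c := by rw [hc, le_div_iff₀ hapos]; linarith
  have hsc : 1 ≤ √c := Real.one_le_sqrt.2 hc1
  have hsc2 : √c ^ 2 = c := Real.sq_sqrt (by linarith)
  have hlog : Real.log (4 * δ + 1) ≤ Real.log (a + 1) + 2 * (√c - 1) := by
    have h1 : Real.log (4 * δ + 1) ≤ Real.log ((a + 1) * c) :=
      Real.log_le_log (by linarith) (by linarith)
    have h2 : Real.log c = 2 * Real.log √c := by
      rw [Real.log_sqrt (by linarith)]; ring
    rw [Real.log_mul (by positivity) (by positivity), h2] at h1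
    have h3 := Real.log_le_sub_one_of_pos (x := √c) (by linarith)
    linarith
  have hs0 : 0 ≤ Real.log (4 * δ + 1) := Real.log_nonneg (by linarith)
  have hs : 1 + Real.log (4 * δ + 1) ≤ ℓ * √c := by nlinarith
  have hs2 : (1 + Real.log (4 * δ + 1)) ^ 2 ≤ ℓ ^ 2 * c := by
    rw [← hsc2, ← mul_pow]
    exact pow_le_pow_left₀ (by linarith) hs 2
  have hℓ0 : 0 < ℓ := by linarith
  rw [div_le_div_iff₀ (by positivity) (by positivity)]
  calc √p * (20 * (1 + Real.log (4 * δ + 1)) ^ 2) ≤ √p * (20 * (ℓ ^ 2 * c)) := by gcongr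
    _ = (80 * √p) * (ℓ ^ 2 * c) / 4 := by ring
    _ ≤ (33 * a) * (ℓ ^ 2 * c) / 4 := by gcongr
    _ = δ * (33 * ℓ ^ 2) := by linear_combination (33 * ℓ ^ 2 / 4) * hca

theorem sqrt_div_le_stepSize_mul {n : ℕ} {V : SymMat n} (hV : V.1.PosDef) (h1 : 1 ≤ Psi V)
    {p₀ : ℝ} (hp₀ : Psi V ≤ p₀) :
    √(Psi V) / (33 * (1 + Real.log (2 * √(2 * p₀) + 1)) ^ 2) ≤ stepSize V * delta V ^ 2 := by
  have hδ0 : 0 ≤ delta V := by rw [delta]; positivity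
  have hδ : √(Psi V) ≤ delta V := Real.sqrt_le_iff.2 ⟨hδ0, Psi_le_delta_sq hV⟩
  have hδ1 : 1 ≤ delta V := (Real.one_le_sqrt.2 h1).trans hδ
  refine (sqrt_div_le_of_sqrt_le h1 hp₀ hδ).trans ?_
  have hb := deriv_deriv_psi_rho_le hδ1
  have hpos : 0 < deriv (deriv psi) (rho (2 * delta V)) :=
    two_pos.trans_le (two_le_deriv_deriv_psi (rho_spec (by positivity)).1)
  have hlog : 0 ≤ Real.log (4 * delta V + 1) := Real.log_nonneg (by linarith)
  rw [stepSize, one_div_mul_eq_div, div_le_div_iff₀ (by positivity) hpos]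
  calc delta V * deriv (deriv psi) (rho (2 * delta V))
      ≤ delta V * (20 * delta V * (1 + Real.log (4 * delta V + 1)) ^ 2) := by gcongr
    _ = delta V ^ 2 * (20 * (1 + Real.log (4 * delta V + 1)) ^ 2) := by ring

theorem sqrt_le_sqrt_sub {p q ℓ : ℝ} (hp : 1 ≤ p) (hℓ : 1 ≤ ℓ)
    (h : q ≤ p - √p / (33 * ℓ ^ 2)) : √q ≤ √p - 1 / (66 * ℓ ^ 2) := by
  have hsp : 1 ≤ √p := Real.one_le_sqrt.2 hp
  have hb : 1 / (66 * ℓ ^ 2) ≤ 1 := by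
    rw [div_le_one (by positivity)]
    nlinarith
  -- This form also covers negative `q`, where `√q = 0`, so nonnegativity of `Ψ` is not needed.
  refine Real.sqrt_le_iff.2 ⟨by linarith, h.trans ?_⟩
  have e : √p / (33 * ℓ ^ 2) = 2 * √p * (1 / (66 * ℓ ^ 2)) := by
    field_simp
    norm_num
  rw [e, sub_sq, Real.sq_sqrt (by linarith)]
  nlinarith [sq_nonneg (1 / (66 * ℓ ^ 2))]

section run

variable {n : ℕ} {L : SymMat n →ₗ[ℝ] SymMat n} {Q : SymMat n} {τ μ : ℝ}
  {z₀ : SymMat n × SymMat n}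

/-- The bound `Ψ ≤ Ψ₀` is carried through the induction so that the logarithmic factor can be frozen
at `Ψ₀`, making the decrease of `√Ψ` uniform. -/
theorem IsInnerRun.feasible_and_sqrt_le (hL : IsMonotone L) (hτ : 1 ≤ τ) (hμ : 0 < μ)
    (hz₀ : z₀ ∈ strictlyFeasible L Q) {K : ℕ} {z : ℕ → SymMat n × SymMat n}
    (h : IsInnerRun L τ μ z₀ K z) : ∀ k ≤ K,
      z k ∈ strictlyFeasible L Q ∧ Psi (scaledV μ (z k)) ≤ Psi (scaledV μ z₀) ∧
      √(Psi (scaledV μ (z k))) ≤ √(Psi (scaledV μ z₀)) -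
        k * (1 / (66 * (1 + Real.log (2 * √(2 * Psi (scaledV μ z₀)) + 1)) ^ 2)) := by
  intro k
  induction k with
  | zero =>
    intro _
    rw [h.1]
    exact ⟨hz₀, le_rfl, by simp⟩
  | succ k ih =>
    intro hk
    obtain ⟨hf, hle, hsq⟩ := ih (by omega)
    obtain ⟨hgt, hstep⟩ := h.2 k (by omega)
    obtain ⟨hf', hdec⟩ := hstep.descent hL hμ hf
    have h1 : 1 ≤ Psi (scaledV μ (z k)) := hτ.trans hgt.le
    have hd := sqrt_div_le_stepSize_mul (scaledV_posDef hμ hf.2.1 hf.2.2) h1 hle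
    have hlog : 0 ≤ Real.log (2 * √(2 * Psi (scaledV μ z₀)) + 1) :=
      Real.log_nonneg (by linarith [Real.sqrt_nonneg (2 * Psi (scaledV μ z₀))])
    have hs := sqrt_le_sqrt_sub h1 (ℓ := 1 + Real.log (2 * √(2 * Psi (scaledV μ z₀)) + 1))
      (by linarith) (hdec.trans (by linarith))
    have hnn : 0 ≤ √(Psi (scaledV μ (z k))) /
        (33 * (1 + Real.log (2 * √(2 * Psi (scaledV μ z₀)) + 1)) ^ 2) := by positivity
    refine ⟨hf', by linarith, ?_⟩
    push_cast
    linarith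

theorem IsInnerRun.length_le (hL : IsMonotone L) (hτ : 1 ≤ τ) (hμ : 0 < μ)
    (hz₀ : z₀ ∈ strictlyFeasible L Q) {K : ℕ} {z : ℕ → SymMat n × SymMat n}
    (h : IsInnerRun L τ μ z₀ K z) :
    (K : ℝ) ≤ 66 * (1 + Real.log (2 * √(2 * Psi (scaledV μ z₀)) + 1)) ^ 2 *
      √(Psi (scaledV μ z₀)) := by
  obtain ⟨-, -, hs⟩ := h.feasible_and_sqrt_le hL hτ hμ hz₀ K le_rfl
  have hlog : 0 ≤ Real.log (2 * √(2 * Psi (scaledV μ z₀)) + 1) :=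
    Real.log_nonneg (by linarith [Real.sqrt_nonneg (2 * Psi (scaledV μ z₀))])
  have h1 := (Real.sqrt_nonneg _).trans hs
  rw [mul_one_div, sub_nonneg, div_le_iff₀ (by positivity)] at h1
  linarith

theorem IsInnerRun.extend (hL : IsMonotone L) (hτ : 1 ≤ τ) (hμ : 0 < μ)
    (hz₀ : z₀ ∈ strictlyFeasible L Q) {K : ℕ} {z : ℕ → SymMat n × SymMat n}
    (h : IsInnerRun L τ μ z₀ K z) (hK : τ < Psi (scaledV μ (z K))) :
    ∃ z', IsInnerRun L τ μ z₀ (K + 1) z' := by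
  obtain ⟨hf, -⟩ := h.feasible_and_sqrt_le hL hτ hμ hz₀ K le_rfl
  obtain ⟨w, hw⟩ := exists_innerStep hL hμ hf.2.1 hf.2.2
  refine ⟨Function.update z (K + 1) w, ?_, fun k hk => ?_⟩
  · rw [Function.update_of_ne (by omega), h.1]
  · rw [Function.update_of_ne (by omega)]
    rcases Nat.lt_succ_iff_lt_or_eq.1 hk with hlt | rfl
    · rw [Function.update_of_ne (by omega)]
      exact h.2 k hlt
    · rw [Function.update_self]
      exact ⟨hK, hw⟩

theorem exists_isInnerRun_terminating (hL : IsMonotone L) (hτ : 1 ≤ τ) (hμ : 0 < μ)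
    (hz₀ : z₀ ∈ strictlyFeasible L Q) :
    ∃ (K : ℕ) (z : ℕ → SymMat n × SymMat n), IsInnerRun L τ μ z₀ K z ∧
      z K ∈ strictlyFeasible L Q ∧ Psi (scaledV μ (z K)) ≤ τ := by
  -- If no run stopped, every run could be extended, giving runs longer than `IsInnerRun.length_le`
  -- allows.
  by_contra! hcon
  have hall : ∀ K : ℕ, ∃ z, IsInnerRun L τ μ z₀ K z := by
    intro K
    induction K with
    | zero => exact ⟨fun _ => z₀, rfl, fun k hk => absurd hk (Nat.not_lt_zero k)⟩
    | succ K ih =>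
      obtain ⟨z, hz⟩ := ih
      exact hz.extend hL hτ hμ hz₀
        (hcon K z hz (hz.feasible_and_sqrt_le hL hτ hμ hz₀ K le_rfl).1)
  obtain ⟨K, hK⟩ := exists_nat_gt (66 * (1 + Real.log (2 * √(2 * Psi (scaledV μ z₀)) + 1)) ^ 2 *
      √(Psi (scaledV μ z₀)))
  obtain ⟨z, hz⟩ := hall K
  exact hK.not_ge (hz.length_le hL hτ hμ hz₀)

end run

end SDLCP

theorem mainTheorem2 {n : ℕ}
    (L : SDLCP.SymMat n →ₗ[ℝ] SDLCP.SymMat n) (hL : SDLCP.IsMonotone L) (Q : SDLCP.SymMat n)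
    (τ θ μ : ℝ) (hτ : 1 ≤ τ) (hθ0 : 0 < θ) (hθ1 : θ < 1) (hμ : 0 < μ)
    (z₀ : SDLCP.SymMat n × SDLCP.SymMat n)
    (hz₀ : z₀ ∈ SDLCP.strictlyFeasible L Q)
    (hΨ : SDLCP.Psi (SDLCP.scaledV μ z₀) ≤ τ)
    (Ψ₀ : ℝ) (hΨ₀ : Ψ₀ = SDLCP.Psi (SDLCP.scaledV ((1 - θ) * μ) z₀)) :
    (∃ (K : ℕ) (z : ℕ → SDLCP.SymMat n × SDLCP.SymMat n),
      SDLCP.IsInnerRun L τ ((1 - θ) * μ) z₀ K z ∧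
      z K ∈ SDLCP.strictlyFeasible L Q ∧
      SDLCP.Psi (SDLCP.scaledV ((1 - θ) * μ) (z K)) ≤ τ) ∧
    (∀ (K : ℕ) (z : ℕ → SDLCP.SymMat n × SDLCP.SymMat n),
      SDLCP.IsInnerRun L τ ((1 - θ) * μ) z₀ K z →
      (K : ℝ) ≤ 66 * (1 + Real.log (2 * √(2 * Ψ₀) + 1)) ^ 2 * √Ψ₀) := by
  have hμ' : 0 < (1 - θ) * μ := mul_pos (by linarith) hμ
  subst hΨ₀
  exact ⟨SDLCP.exists_isInnerRun_terminating hL hτ hμ' hz₀,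
    fun K z hz => hz.length_le hL hτ hμ' hz₀⟩
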